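/- Let $k$ be an algebraically closed field of characteristic $0$. A coquasi-Hopf algebra over $k$ is a coalgebra $(M,\Delta,\varepsilon)$ with coalgebra morphisms $m\colon M\otimes M\to M$, $a\otimes b\mapsto ab$, and $k\to M$, $\lambda\mapsto\lambda 1$, a convolution-invertible functional $\Phi\colon M^{\otimes 3}\to k$, a coalgebra antimorphism $S\colon M\to M$ and functionals $\alpha,\beta\colon M\to k$ such that, for all $a,b,c,d\in M$ (in Sweedler notation), \begin{align*} &a_1(b_1c_1)\,\Phi(a_2,b_2,c_2)=\Phi(a_1,b_1,c_1)\,(a_2b_2)c_2,\qquad 1a=a=a1,\\ &\Phi(a_1,b_1,c_1d_1)\,\Phi(a_2b_2,c_2,d_2)=\Phi(b_1,c_1,d_1)\,\Phi(a_1,b_2c_2,d_2)\,\Phi(a_2,b_3,c_3),\\ &\Phi(a,1,b)=\varepsilon(a)\varepsilon(b),\qquad S(a_1)\alpha(a_2)a_3=\alpha(a)1,\qquad a_1\beta(a_2)S(a_3)=\beta(a)1,\\ &\Phi(a_1,S(a_3),a_5)\beta(a_2)\alpha(a_4)=\Phi^{-1}(S(a_1),a_3,S(a_5))\alpha(a_2)\beta(a_4)=\varepsilon(a).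 \end{align*} It is called pointed if every simple $M$-comodule is one-dimensional. Let $\operatorname{comod}(M)$ be the category of finite-dimensional left $M$-comodules, where $V\otimes W$ carries the coaction $v\otimes w\mapsto v_{-1}w_{-1}\otimes(v_0\otimes w_0)$ and the unit object is $k$ with coaction $\lambda\mapsto 1\otimes\lambda$. It is said to be tensor generated by a class $\mathcal P$ of objects if every object is a subquotient of a finite direct sum of tensor products (with any bracketing; the empty product is the unit object) of finitely many objects from $\mathcal P$. An element $g\in M$ is grouplike if $\Delta(g)=g\otimes g$ and $\varepsilon(g)=1$, and $x\in M$ is skew-primitive if $\Delta(x)=g\otimes x+x\otimes h$ for some grouplike $g,h$. Let $M$ be a finite-dimensional pointed coquasi-Hopf algebra over $k$. Then the only subspace of $M$ that contains all grouplike and skew-primitive elements and is closed under multiplication is $M$ itself (that is, $M$ is generated by grouplike and skew-primitive elements) if and only if $\operatorname{comod}(M)$ is tensor generated by objects of length $2$. -/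

import Mathlib

open scoped TensorProduct
open Coalgebra

universe u

/-! ### Sweedler calculus: contractions with functionals -/

section Sweedler

variable {k C V : Type*} [Field k] [AddCommGroup C] [Module k C] [Coalgebra k C]
  [AddCommGroup V] [Module k V]

/-- `c ↦ φ(c₁) f(c₂)`. For `V = k` this is the convolution product of two functionals. -/
noncomputable def convL (φ : C →ₗ[k] k) (f : C →ₗ[k] V) : C →ₗ[k] V :=
  (TensorProduct.lid k V).toLinearMap ∘ₗ TensorProduct.map φ f ∘ₗ comul

/-- `c ↦ f(c₁) φ(c₂)`. -/
noncomputable def convR (f : C →ₗ[k] V) (φ : C →ₗ[k] k) : C →ₗ[k] V :=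
  (TensorProduct.rid k V).toLinearMap ∘ₗ TensorProduct.map f φ ∘ₗ comul

/-- `c ↦ c₁ ⊗ φ(c₂) c₃`. -/
noncomputable def contract₁ (φ : C →ₗ[k] k) : C →ₗ[k] C ⊗[k] C :=
  (convL φ LinearMap.id).lTensor C ∘ₗ comul

/-- `c ↦ c₁ ⊗ (φ(c₂) c₃ ⊗ ψ(c₄) c₅)`. -/
noncomputable def contract₂ (φ ψ : C →ₗ[k] k) : C →ₗ[k] C ⊗[k] (C ⊗[k] C) :=
  (contract₁ ψ ∘ₗ convL φ LinearMap.id).lTensor C ∘ₗ comul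

end Sweedler

/-! ### Coquasi-Hopf algebras -/

/-- A coquasi-Hopf algebra structure on a coalgebra `M` over the field `k`: a multiplication and a
unit which are coalgebra morphisms, an associator `Φ` (a convolution-invertible functional on
`M ⊗ M ⊗ M`) and a quasi-antipode `(S, α, β)`. The multiplication need not be associative. -/
class CoquasiHopfAlgebra (k M : Type*) [Field k] [AddCommGroup M] [Module k M]
    [Coalgebra k M] where
  /-- The multiplication, a coalgebra morphism. -/
  mul : M ⊗[k] M →ₗc[k] M
  /-- The unit map `l ↦ l 1`, a coalgebra morphism. -/
  unit : k →ₗc[k] M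
  /-- The associator `Φ`. -/
  Φ : M ⊗[k] (M ⊗[k] M) →ₗ[k] k
  /-- The convolution inverse of `Φ`. -/
  Φinv : M ⊗[k] (M ⊗[k] M) →ₗ[k] k
  /-- The map `S` of the quasi-antipode. -/
  S : M →ₗ[k] M
  /-- The functional `α` of the quasi-antipode. -/
  α : M →ₗ[k] k
  /-- The functional `β` of the quasi-antipode. -/
  β : M →ₗ[k] k
  Φ_conv_Φinv : convL Φ Φinv = counit
  Φinv_conv_Φ : convL Φinv Φ = counit
  /-- `S` reverses the comultiplication: `Δ(S(a)) = S(a₂) ⊗ S(a₁)`. -/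
  comul_S : comul ∘ₗ S =
    TensorProduct.map S S ∘ₗ (TensorProduct.comm k M M).toLinearMap ∘ₗ comul
  /-- `ε(S(a)) = ε(a)`. -/
  counit_S : counit ∘ₗ S = (counit : M →ₗ[k] k)
  /-- `a₁(b₁c₁) Φ(a₂,b₂,c₂) = Φ(a₁,b₁,c₁) (a₂b₂)c₂`. -/
  quasi_assoc :
    convR (mul.toLinearMap ∘ₗ mul.toLinearMap.lTensor M) Φ =
      convL Φ (mul.toLinearMap ∘ₗ mul.toLinearMap.rTensor M ∘ₗ
        (TensorProduct.assoc k M M M).symm.toLinearMap)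
  /-- `1 a = a`. -/
  one_mul : ∀ a : M, mul (unit 1 ⊗ₜ[k] a) = a
  /-- `a 1 = a`. -/
  mul_one : ∀ a : M, mul (a ⊗ₜ[k] unit 1) = a
  /-- `Φ(a₁,b₁,c₁d₁) Φ(a₂b₂,c₂,d₂) = Φ(b₁,c₁,d₁) Φ(a₁,b₂c₂,d₂) Φ(a₂,b₃,c₃)`, as an identity of
  functionals of `a ⊗ (b ⊗ (c ⊗ d))`. -/
  pentagon :
    convL
      (Φ ∘ₗ (mul.toLinearMap.lTensor M).lTensor M)
      (Φ ∘ₗ mul.toLinearMap.rTensor (M ⊗[k] M) ∘ₗ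
        (TensorProduct.assoc k M M (M ⊗[k] M)).symm.toLinearMap) =
    convL
      ((TensorProduct.lid k k).toLinearMap ∘ₗ TensorProduct.map counit Φ)
      (convL
        (Φ ∘ₗ (mul.toLinearMap.rTensor M ∘ₗ
          (TensorProduct.assoc k M M M).symm.toLinearMap).lTensor M)
        ((TensorProduct.lid k k).toLinearMap ∘ₗ TensorProduct.map Φ counit ∘ₗ
          (TensorProduct.assoc k M (M ⊗[k] M) M).symm.toLinearMap ∘ₗ
          (TensorProduct.assoc k M M M).symm.toLinearMap.lTensor M))
  /-- `Φ(a,1,b) = ε(a) ε(b)`. -/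
  Φ_one : ∀ a b : M, Φ (a ⊗ₜ[k] (unit 1 ⊗ₜ[k] b)) = counit (R := k) a * counit (R := k) b
  /-- `S(a₁) α(a₂) a₃ = α(a) 1`. -/
  S_α : ∀ a : M, mul (S.rTensor M (contract₁ α a)) = α a • unit 1
  /-- `a₁ β(a₂) S(a₃) = β(a) 1`. -/
  β_S : ∀ a : M, mul (S.lTensor M (contract₁ β a)) = β a • unit 1
  /-- `Φ(a₁,S(a₃),a₅) β(a₂) α(a₄) = ε(a)`. -/
  Φ_S : ∀ a : M, Φ ((S.rTensor M).lTensor M (contract₂ β α a)) = counit (R := k) a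
  /-- `Φ⁻¹(S(a₁),a₃,S(a₅)) α(a₂) β(a₄) = ε(a)`. -/
  Φinv_S : ∀ a : M,
    Φinv (TensorProduct.map S (S.lTensor M) (contract₂ α β a)) = counit (R := k) a

section Generation

variable (k : Type*) {M : Type*} [Field k] [AddCommGroup M] [Module k M] [Coalgebra k M]

/-- `x` is skew-primitive: `Δ(x) = g ⊗ x + x ⊗ h` for some grouplike `g`, `h`. -/
def IsSkewPrimitive (x : M) : Prop :=
  ∃ g h : M, IsGroupLikeElem k g ∧ IsGroupLikeElem k h ∧ comul (R := k) x = g ⊗ₜ[k] x + x ⊗ₜ[k] h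

variable (M) in
/-- `M` is generated, as a (not necessarily associative) algebra, by its grouplike and
skew-primitive elements: the only subspace which contains them and is closed under
multiplication is `M`. The unit is grouplike. -/
def GeneratedByGroupLikeAndSkewPrimitive [CoquasiHopfAlgebra k M] : Prop :=
  ∀ N : Submodule k M, (∀ g : M, IsGroupLikeElem k g → g ∈ N) →
    (∀ x : M, IsSkewPrimitive k x → x ∈ N) →
    (∀ a ∈ N, ∀ b ∈ N, CoquasiHopfAlgebra.mul (k := k) (a ⊗ₜ[k] b) ∈ N) → N = ⊤

end Generation

/-! ### Finite-dimensional (left) comodules -/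

/-- The objects of `comod(M)`: finite-dimensional left `M`-comodules. -/
structure FDComod (k M : Type u) [Field k] [AddCommGroup M] [Module k M] [Coalgebra k M] where
  /-- The underlying vector space. -/
  carrier : Type u
  [addCommGroup : AddCommGroup carrier]
  [module : Module k carrier]
  [finite : Module.Finite k carrier]
  /-- The coaction. -/
  coact : carrier →ₗ[k] M ⊗[k] carrier
  /-- `(Δ ⊗ id) δ = (id ⊗ δ) δ`. -/
  coassoc : ∀ v, TensorProduct.assoc k M M carrier ((comul (R := k)).rTensor carrier (coact v)) =
    coact.lTensor M (coact v)
  /-- `(ε ⊗ id) δ = id`. -/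
  counit_coact : ∀ v, (counit (R := k)).rTensor carrier (coact v) = 1 ⊗ₜ[k] v

namespace FDComod

attribute [instance] addCommGroup module finite

section Coalgebra

variable {k M : Type u} [Field k] [AddCommGroup M] [Module k M] [Coalgebra k M]

/-- A linear map is a morphism of comodules if it commutes with the coactions. -/
def IsHom {X Y : FDComod k M} (f : X.carrier →ₗ[k] Y.carrier) : Prop :=
  ∀ v, Y.coact (f v) = f.lTensor M (X.coact v)

/-- `Y` is a subquotient of `Z`: a quotient of a subobject `W` of `Z`. -/
def IsSubquotient (Y Z : FDComod k M) : Prop :=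
  ∃ (W : FDComod k M) (i : W.carrier →ₗ[k] Z.carrier) (p : W.carrier →ₗ[k] Y.carrier),
    IsHom i ∧ Function.Injective i ∧ IsHom p ∧ Function.Surjective p

/-- A subspace `W` is a subcomodule if the coaction maps it into `M ⊗ W`. -/
def IsSubcomodule (X : FDComod k M) (W : Submodule k X.carrier) : Prop :=
  ∀ w ∈ W, X.coact w ∈ LinearMap.range (W.subtype.lTensor M)

/-- The partially ordered set of subcomodules of `X`. -/
abbrev Subcomodule (X : FDComod k M) : Type u :=
  { W : Submodule k X.carrier // X.IsSubcomodule W }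

/-- A simple comodule: nonzero, and without subcomodules except `0` and itself. -/
def IsSimple (X : FDComod k M) : Prop :=
  Nontrivial X.carrier ∧ ∀ W : Submodule k X.carrier, X.IsSubcomodule W → W = ⊥ ∨ W = ⊤

/-- The length of `X`: the maximal length `n` of a chain `W₀ < W₁ < ⋯ < Wₙ` of subcomodules. -/
noncomputable def length (X : FDComod k M) : WithBot ℕ∞ :=
  Order.krullDim X.Subcomodule

/-- The direct sum of finitely many comodules. -/
noncomputable def directSum {n : ℕ} (X : Fin n → FDComod k M) : FDComod k M where
  carrier := ∀ i, (X i).carrier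
  coact := ∑ i, (LinearMap.single k (fun i => (X i).carrier) i).lTensor M ∘ₗ (X i).coact ∘ₗ
    LinearMap.proj i
  coassoc v := by
    simp only [LinearMap.sum_apply, LinearMap.comp_apply, LinearMap.proj_apply, map_sum]
    refine Finset.sum_congr rfl fun i _ => ?_
    have h := congrArg ((LinearMap.single k (fun i => (X i).carrier) i).lTensor M |>.lTensor M)
      ((X i).coassoc (v i))
    have h1 : ∀ x : M ⊗[k] (X i).carrier,
        TensorProduct.assoc k M M (∀ i, (X i).carrier) ((comul (R := k)).rTensor _
          ((LinearMap.single k (fun i => (X i).carrier) i).lTensor M x)) =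
        ((LinearMap.single k (fun i => (X i).carrier) i).lTensor M).lTensor M
          (TensorProduct.assoc k M M _ ((comul (R := k)).rTensor _ x)) := by
      intro x
      induction x using TensorProduct.induction_on with
      | zero => simp
      | add x y hx hy => simp only [map_add, hx, hy]
      | tmul a w =>
        simp only [LinearMap.lTensor_tmul, LinearMap.rTensor_tmul]
        generalize comul (R := k) a = z
        induction z using TensorProduct.induction_on with
        | zero => simp
        | add x y hx hy => simp only [TensorProduct.add_tmul, map_add, hx, hy]
        | tmul b c => simp
    rw [h1, h, ← LinearMap.lTensor_comp_apply, ← LinearMap.lTensor_comp_apply]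
    congr 2
    ext w
    simp only [LinearMap.comp_apply, LinearMap.sum_apply, LinearMap.proj_apply]
    rw [Finset.sum_eq_single i]
    · simp
    · intro j _ hj
      simp [Pi.single_eq_of_ne hj]
    · simp
  counit_coact v := by
    simp only [LinearMap.sum_apply, LinearMap.comp_apply, LinearMap.proj_apply, map_sum]
    have h1 : ∀ i, (counit (R := k)).rTensor _
        ((LinearMap.single k (fun i => (X i).carrier) i).lTensor M ((X i).coact (v i))) =
        (1 : k) ⊗ₜ[k] (Pi.single i (v i) : ∀ i, (X i).carrier) := by
      intro i
      rw [← LinearMap.comp_apply, LinearMap.rTensor_comp_lTensor, ← LinearMap.lTensor_comp_rTensor,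
        LinearMap.comp_apply, (X i).counit_coact]
      simp
    simp only [h1, ← TensorProduct.tmul_sum, Finset.univ_sum_single]

end Coalgebra

section Tensor

variable (k M : Type u) [Field k] [AddCommGroup M] [Module k M] [Coalgebra k M]
  [CoquasiHopfAlgebra k M]

/-- The unit object `k`, with coaction `v ↦ 1 ⊗ v`. -/
noncomputable def unitObj : FDComod k M where
  carrier := k
  coact := TensorProduct.mk k M k (CoquasiHopfAlgebra.unit (1 : k))
  coassoc v := by
    have h : comul (R := k) (CoquasiHopfAlgebra.unit (1 : k) : M) =
        CoquasiHopfAlgebra.unit (1 : k) ⊗ₜ[k] CoquasiHopfAlgebra.unit (1 : k) := by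
      rw [← CoalgHomClass.map_comp_comul_apply]
      simp
    simp [h]
  counit_coact v := by
    have h : counit (R := k) (CoquasiHopfAlgebra.unit (1 : k) : M) = 1 := by
      rw [CoalgHomClass.counit_comp_apply]
      simp
    simp [h]

variable {k M}

/-- The coaction `v ⊗ w ↦ v₋₁ w₋₁ ⊗ (v₀ ⊗ w₀)` on a tensor product. -/
noncomputable def tensorCoact (X Y : FDComod k M) :
    X.carrier ⊗[k] Y.carrier →ₗ[k] M ⊗[k] (X.carrier ⊗[k] Y.carrier) :=
  (CoquasiHopfAlgebra.mul (k := k) (M := M)).toLinearMap.rTensor (X.carrier ⊗[k] Y.carrier) ∘ₗ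
    (TensorProduct.tensorTensorTensorComm k M X.carrier M Y.carrier).toLinearMap ∘ₗ
    TensorProduct.map X.coact Y.coact

/-- The tensor product of two comodules. -/
noncomputable def tensorObj (X Y : FDComod k M) : FDComod k M where
  carrier := X.carrier ⊗[k] Y.carrier
  coact := tensorCoact X Y
  coassoc v := by
    have hm : ∀ z : M ⊗[k] M, comul (R := k) (CoquasiHopfAlgebra.mul z) =
        TensorProduct.map (CoquasiHopfAlgebra.mul (k := k) (M := M)).toLinearMap
          (CoquasiHopfAlgebra.mul (k := k) (M := M)).toLinearMap (comul (R := k) z) := fun z =>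
      (CoalgHomClass.map_comp_comul_apply (CoquasiHopfAlgebra.mul (k := k) (M := M)) z).symm
    let F : (M ⊗[k] (M ⊗[k] X.carrier)) ⊗[k] (M ⊗[k] (M ⊗[k] Y.carrier)) →ₗ[k]
        M ⊗[k] (M ⊗[k] (X.carrier ⊗[k] Y.carrier)) :=
      TensorProduct.map (CoquasiHopfAlgebra.mul (k := k) (M := M)).toLinearMap
        ((CoquasiHopfAlgebra.mul (k := k) (M := M)).toLinearMap.rTensor _ ∘ₗ
          (TensorProduct.tensorTensorTensorComm k M X.carrier M Y.carrier).toLinearMap) ∘ₗ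
        (TensorProduct.tensorTensorTensorComm k M (M ⊗[k] X.carrier) M
          (M ⊗[k] Y.carrier)).toLinearMap
    let T : (M ⊗[k] X.carrier) ⊗[k] (M ⊗[k] Y.carrier) →ₗ[k]
        M ⊗[k] (X.carrier ⊗[k] Y.carrier) :=
      (CoquasiHopfAlgebra.mul (k := k) (M := M)).toLinearMap.rTensor _ ∘ₗ
        (TensorProduct.tensorTensorTensorComm k M X.carrier M Y.carrier).toLinearMap
    have h1 : ∀ (x : M ⊗[k] X.carrier) (y : M ⊗[k] Y.carrier),
        TensorProduct.assoc k M M _ ((comul (R := k)).rTensor _ (T (x ⊗ₜ y))) =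
        F (TensorProduct.assoc k M M _ ((comul (R := k)).rTensor _ x) ⊗ₜ
          TensorProduct.assoc k M M _ ((comul (R := k)).rTensor _ y)) := by
      intro x y
      induction x using TensorProduct.induction_on with
      | zero => simp
      | add x x' hx hx' => simp only [TensorProduct.add_tmul, map_add, hx, hx']
      | tmul a v =>
        induction y using TensorProduct.induction_on with
        | zero => simp
        | add y y' hy hy' => simp only [TensorProduct.tmul_add, map_add, hy, hy']
        | tmul b w =>
          simp only [T, LinearMap.comp_apply, LinearEquiv.coe_coe, LinearMap.rTensor_tmul,
            TensorProduct.tensorTensorTensorComm_tmul, CoalgHom.toLinearMap_eq_coe,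
            CoalgHom.coe_toLinearMap, hm, TensorProduct.comul_tmul]
          generalize comul (R := k) a = p
          generalize comul (R := k) b = q
          induction p using TensorProduct.induction_on with
          | zero => simp
          | add x x' hx hx' => simp only [TensorProduct.add_tmul, map_add, hx, hx']
          | tmul a₁ a₂ =>
            induction q using TensorProduct.induction_on with
            | zero => simp
            | add y y' hy hy' =>
              simp only [TensorProduct.tmul_add, TensorProduct.add_tmul, map_add, hy, hy']
            | tmul b₁ b₂ => simp [F]
    have h2 : ∀ (x : M ⊗[k] X.carrier) (y : M ⊗[k] Y.carrier),
        (tensorCoact X Y).lTensor M (T (x ⊗ₜ y)) =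
        F (X.coact.lTensor M x ⊗ₜ Y.coact.lTensor M y) := by
      intro x y
      induction x using TensorProduct.induction_on with
      | zero => simp
      | add x x' hx hx' => simp only [TensorProduct.add_tmul, map_add, hx, hx']
      | tmul a v =>
        induction y using TensorProduct.induction_on with
        | zero => simp
        | add y y' hy hy' => simp only [TensorProduct.tmul_add, map_add, hy, hy']
        | tmul b w => simp [T, F, tensorCoact]
    induction v using TensorProduct.induction_on with
    | zero => simp
    | add x y hx hy => simp only [map_add, hx, hy]
    | tmul v w =>
      have h3 : tensorCoact X Y (v ⊗ₜ w) = T (X.coact v ⊗ₜ Y.coact w) := rfl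
      rw [h3, h1, h2, X.coassoc, Y.coassoc]
  counit_coact v := by
    have hm : ∀ z : M ⊗[k] M, counit (R := k) (CoquasiHopfAlgebra.mul (k := k) z) =
        counit (R := k) z := fun z =>
      CoalgHomClass.counit_comp_apply (CoquasiHopfAlgebra.mul (k := k) (M := M)) z
    let F : (k ⊗[k] X.carrier) ⊗[k] (k ⊗[k] Y.carrier) →ₗ[k]
        k ⊗[k] (X.carrier ⊗[k] Y.carrier) :=
      (TensorProduct.lid k k).toLinearMap.rTensor _ ∘ₗ
        (TensorProduct.tensorTensorTensorComm k k X.carrier k Y.carrier).toLinearMap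
    have h1 : ∀ (x : M ⊗[k] X.carrier) (y : M ⊗[k] Y.carrier),
        (counit (R := k)).rTensor _
          ((CoquasiHopfAlgebra.mul (k := k) (M := M)).toLinearMap.rTensor _
            (TensorProduct.tensorTensorTensorComm k M X.carrier M Y.carrier (x ⊗ₜ y))) =
        F ((counit (R := k)).rTensor _ x ⊗ₜ (counit (R := k)).rTensor _ y) := by
      intro x y
      induction x using TensorProduct.induction_on with
      | zero => simp
      | add x x' hx hx' => simp only [TensorProduct.add_tmul, map_add, hx, hx']
      | tmul a v =>
        induction y using TensorProduct.induction_on with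
        | zero => simp
        | add y y' hy hy' => simp only [TensorProduct.tmul_add, map_add, hy, hy']
        | tmul b w => simp [F, hm, mul_comm]
    induction v using TensorProduct.induction_on with
    | zero => simp
    | add x y hx hy => simp only [map_add, TensorProduct.tmul_add, hx, hy]
    | tmul v w =>
      have h3 := h1 (X.coact v) (Y.coact w)
      rw [X.counit_coact, Y.counit_coact] at h3
      refine h3.trans ?_
      simp [F]

/-- The tensor products, in any bracketing, of finitely many objects from the class `P`
(the unit object being the empty product). -/
inductive IsTensorWord (P : FDComod k M → Prop) : FDComod k M → Prop
  | unit : IsTensorWord P (unitObj k M)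
  | of (X : FDComod k M) : P X → IsTensorWord P X
  | tensor (X Y : FDComod k M) : IsTensorWord P X → IsTensorWord P Y →
      IsTensorWord P (tensorObj X Y)

/-- `comod(M)` is tensor generated by the class `P` of objects: every object is a subquotient of
a finite direct sum of tensor products of objects from `P`. -/
def TensorGeneratedBy (P : FDComod k M → Prop) : Prop :=
  ∀ Y : FDComod k M, ∃ (n : ℕ) (X : Fin n → FDComod k M),
    (∀ i, IsTensorWord P (X i)) ∧ IsSubquotient Y (directSum X)

end Tensor

end FDComod

/-- A coalgebra is pointed if every simple comodule is one-dimensional. (Simple comodules are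
finite-dimensional.) -/
def IsPointedCoalgebra (k M : Type u) [Field k] [AddCommGroup M] [Module k M]
    [Coalgebra k M] : Prop :=
  ∀ X : FDComod k M, X.IsSimple → Module.finrank k X.carrier = 1

/-! The link between elements of `M` and objects of `comod(M)` is the matrix coefficient `v₋₁ f(v₀)`
of a comodule `X`. Coefficients behave well under the operations in the definition of tensor
generation: those of a subquotient or of a direct sum lie in any subspace containing those of the
original objects, and, because the coaction on `X ⊗ Y` multiplies the `M`-legs, those of `X ⊗ Y` are
spanned by products of coefficients of `X` and `Y`. Objects of length `2` correspond to the
generators: if `M` is pointed, such an object is an extension of two one-dimensional comodules, so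
its coefficients are combinations of two grouplikes and one skew-primitive
(`coeffsIn_of_length_eq_two`); conversely every grouplike or skew-primitive element is a coefficient
of a two-dimensional comodule of length `2` (`length_skewPrimitiveObj`).

If length `2` objects tensor generate, then a subspace `N` that is closed under multiplication and
contains the generators contains all coefficients of the regular comodule, and these exhaust `M`
(`eq_top_of_coeffsIn_cofree`).

If `M` is generated, the coefficients of tensor words in length `2` objects span `M`
(`span_coeff_tensorWord_eq_top`). Any `Y` embeds by its coaction into the cofree comodule `M ⊗ Y`.
The comodule maps `v ↦ v₋₁ f(v₀) ⊗ y` from tensor words have images spanning `M ⊗ Y`, and by finite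
dimension finitely many suffice. So `Y` is a subobject of a quotient of a finite direct sum of
words, hence a subquotient of that sum (`tensorGeneratedBy_of_span_coeff_eq_top`). -/

namespace FDComod

/-! ### Linear algebra of `M ⊗ V` -/

section Coalgebra

variable {k M : Type u} [Field k] [AddCommGroup M] [Module k M]

/-- Evaluation of the second tensor factor at a functional. -/
noncomputable def evalRight {V : Type*} [AddCommGroup V] [Module k V] (f : V →ₗ[k] k) :
    M ⊗[k] V →ₗ[k] M :=
  (TensorProduct.rid k M).toLinearMap ∘ₗ f.lTensor M

@[simp]
lemma evalRight_tmul {V : Type*} [AddCommGroup V] [Module k V] (f : V →ₗ[k] k) (a : M) (v : V) :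
    evalRight f (a ⊗ₜ[k] v) = f v • a := by
  simp [evalRight]

lemma evalRight_lTensor {V W : Type*} [AddCommGroup V] [Module k V] [AddCommGroup W] [Module k W]
    (g : V →ₗ[k] W) (f : W →ₗ[k] k) (z : M ⊗[k] V) :
    evalRight f (g.lTensor M z) = evalRight (f ∘ₗ g) z := by
  simp [evalRight, LinearMap.lTensor_comp_apply]

lemma sum_evalRight_coord {V ι : Type*} [AddCommGroup V] [Module k V] [Fintype ι]
    (b : Module.Basis ι k V) (z : M ⊗[k] V) :
    ∑ i, evalRight (b.coord i) z ⊗ₜ[k] b i = z := by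
  induction z using TensorProduct.induction_on with
  | zero => simp
  | add x y hx hy => simp only [map_add, TensorProduct.add_tmul, Finset.sum_add_distrib, hx, hy]
  | tmul a v =>
    simp only [evalRight_tmul, TensorProduct.smul_tmul, ← TensorProduct.tmul_sum]
    simp [b.sum_repr]

variable [Coalgebra k M]

lemma assoc_comul_lTensor {V W : Type*} [AddCommGroup V] [Module k V] [AddCommGroup W]
    [Module k W] (f : V →ₗ[k] W) (z : M ⊗[k] V) :
    TensorProduct.assoc k M M W ((comul (R := k)).rTensor W (f.lTensor M z)) =
      (f.lTensor M).lTensor M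
        (TensorProduct.assoc k M M V ((comul (R := k)).rTensor V z)) := by
  induction z using TensorProduct.induction_on with
  | zero => simp
  | add x y hx hy => simp only [map_add, hx, hy]
  | tmul a w =>
    simp only [LinearMap.lTensor_tmul, LinearMap.rTensor_tmul]
    generalize comul (R := k) a = z
    induction z using TensorProduct.induction_on with
    | zero => simp
    | add x y hx hy => simp only [TensorProduct.add_tmul, map_add, hx, hy]
    | tmul b c => simp

lemma counit_rTensor_lTensor {V W : Type*} [AddCommGroup V] [Module k V] [AddCommGroup W]
    [Module k W] (f : V →ₗ[k] W) (z : M ⊗[k] V) :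
    (counit (R := k)).rTensor W (f.lTensor M z) =
      f.lTensor k ((counit (R := k)).rTensor V z) := by
  rw [← LinearMap.comp_apply, LinearMap.rTensor_comp_lTensor, ← LinearMap.lTensor_comp_rTensor,
    LinearMap.comp_apply]

lemma lTensor_injective {A V W : Type*} [AddCommGroup A] [Module k A] [AddCommGroup V]
    [Module k V] [AddCommGroup W] [Module k W] {f : V →ₗ[k] W} (hf : Function.Injective f) :
    Function.Injective (f.lTensor A) :=
  Module.Flat.lTensor_preserves_injective_linearMap f hf

/-! ### Subcomodules, quotients and subquotients -/

/-- A coaction compatible with an injective linear map into a comodule is a comodule structure. -/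
noncomputable def ofInjective (X : FDComod k M) {V : Type u} [AddCommGroup V] [Module k V]
    (i : V →ₗ[k] X.carrier) (hi : Function.Injective i) (δ : V →ₗ[k] M ⊗[k] V)
    (h : ∀ v, i.lTensor M (δ v) = X.coact (i v)) : FDComod k M where
  carrier := V
  finite := Module.Finite.of_injective i hi
  coact := δ
  coassoc v := by
    -- Tensoring over a field preserves injectivity, so the axiom can be tested in `X`, where it
    -- holds.
    apply lTensor_injective (lTensor_injective hi)
    rw [← assoc_comul_lTensor, h, X.coassoc, ← LinearMap.lTensor_comp_apply,
      ← h, ← LinearMap.lTensor_comp_apply]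
    congr 2
    ext w
    simp [h]
  counit_coact v := by
    apply lTensor_injective hi
    rw [← counit_rTensor_lTensor, h, X.counit_coact, LinearMap.lTensor_tmul]

/-- A coaction compatible with a surjective linear map from a comodule is a comodule structure. -/
noncomputable def ofSurjective (X : FDComod k M) {V : Type u} [AddCommGroup V] [Module k V]
    (p : X.carrier →ₗ[k] V) (hp : Function.Surjective p) (δ : V →ₗ[k] M ⊗[k] V)
    (h : ∀ v, δ (p v) = p.lTensor M (X.coact v)) : FDComod k M where
  carrier := V
  finite := Module.Finite.of_surjective p hp
  coact := δ
  coassoc v := by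
    obtain ⟨w, rfl⟩ := hp v
    rw [h, assoc_comul_lTensor, X.coassoc, ← LinearMap.lTensor_comp_apply,
      ← LinearMap.lTensor_comp_apply]
    congr 2
    ext w
    simp [h]
  counit_coact v := by
    obtain ⟨w, rfl⟩ := hp v
    rw [h, counit_rTensor_lTensor, X.counit_coact, LinearMap.lTensor_tmul]

/-- A subcomodule, as a comodule. -/
noncomputable def subObj (X : FDComod k M) (W : Submodule k X.carrier) (hW : X.IsSubcomodule W) :
    FDComod k M :=
  X.ofInjective W.subtype W.subtype_injective
    ((LinearEquiv.ofInjective _ (lTensor_injective W.subtype_injective)).symm.toLinearMap ∘ₗ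
      (X.coact ∘ₗ W.subtype).codRestrict _ fun w => hW w w.2)
    fun v => by
      have := LinearEquiv.apply_symm_apply
        (LinearEquiv.ofInjective (W.subtype.lTensor M) (lTensor_injective W.subtype_injective))
        ((X.coact ∘ₗ W.subtype).codRestrict _ (fun w => hW w w.2) v)
      exact congrArg Subtype.val this

/-- The inclusion of a subcomodule. -/
noncomputable def subIncl (X : FDComod k M) (W : Submodule k X.carrier) (hW : X.IsSubcomodule W) :
    (X.subObj W hW).carrier →ₗ[k] X.carrier :=
  W.subtype

lemma subIncl_injective (X : FDComod k M) (W : Submodule k X.carrier) (hW : X.IsSubcomodule W) :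
    Function.Injective (X.subIncl W hW) := W.subtype_injective

lemma range_subIncl (X : FDComod k M) (W : Submodule k X.carrier) (hW : X.IsSubcomodule W) :
    LinearMap.range (X.subIncl W hW) = W := W.range_subtype

lemma isHom_subIncl (X : FDComod k M) (W : Submodule k X.carrier) (hW : X.IsSubcomodule W) :
    IsHom (X.subIncl W hW) := fun v => by
  have := LinearEquiv.apply_symm_apply
    (LinearEquiv.ofInjective (W.subtype.lTensor M) (lTensor_injective W.subtype_injective))
    ((X.coact ∘ₗ W.subtype).codRestrict _ (fun w => hW w w.2) v)
  exact (congrArg Subtype.val this).symm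

/-- By right exactness of the tensor product, being a subcomodule becomes a vanishing condition
modulo `W`, which is easier to check and lets the coaction descend to the quotient. -/
lemma range_lTensor_subtype {A V : Type*} [AddCommGroup A] [Module k A] [AddCommGroup V]
    [Module k V] (W : Submodule k V) :
    LinearMap.range (W.subtype.lTensor A) = LinearMap.ker (W.mkQ.lTensor A) := by
  refine (LinearMap.exact_iff.1 (lTensor_exact A ?_ W.mkQ_surjective)).symm
  rw [LinearMap.exact_iff, Submodule.ker_mkQ, Submodule.range_subtype]

/-- The quotient of a comodule by a subcomodule. -/
noncomputable def quotObj (X : FDComod k M) (W : Submodule k X.carrier)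
    (hW : X.IsSubcomodule W) : FDComod k M :=
  X.ofSurjective W.mkQ W.mkQ_surjective
    (W.liftQ (W.mkQ.lTensor M ∘ₗ X.coact) fun w hw => by
      have := hW w hw
      rw [range_lTensor_subtype] at this
      exact this)
    fun _ => rfl

/-- The projection to the quotient by a subcomodule. -/
noncomputable def quotProj (X : FDComod k M) (W : Submodule k X.carrier)
    (hW : X.IsSubcomodule W) : X.carrier →ₗ[k] (X.quotObj W hW).carrier :=
  W.mkQ

lemma quotProj_surjective (X : FDComod k M) (W : Submodule k X.carrier)
    (hW : X.IsSubcomodule W) : Function.Surjective (X.quotProj W hW) := W.mkQ_surjective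

lemma ker_quotProj (X : FDComod k M) (W : Submodule k X.carrier)
    (hW : X.IsSubcomodule W) : LinearMap.ker (X.quotProj W hW) = W := W.ker_mkQ

lemma isHom_quotProj (X : FDComod k M) (W : Submodule k X.carrier) (hW : X.IsSubcomodule W) :
    IsHom (X.quotProj W hW) := fun _ => rfl

lemma IsHom.comp {X Y Z : FDComod k M} {g : Y.carrier →ₗ[k] Z.carrier}
    {f : X.carrier →ₗ[k] Y.carrier} (hg : IsHom g) (hf : IsHom f) : IsHom (g ∘ₗ f) := fun v => by
  rw [LinearMap.comp_apply, hg, hf, LinearMap.lTensor_comp_apply]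

lemma IsHom.isSubcomodule_range {X Y : FDComod k M} {f : X.carrier →ₗ[k] Y.carrier}
    (hf : IsHom f) : Y.IsSubcomodule (LinearMap.range f) := by
  rintro _ ⟨v, rfl⟩
  refine ⟨f.rangeRestrict.lTensor M (X.coact v), ?_⟩
  rw [← LinearMap.lTensor_comp_apply, hf, LinearMap.subtype_comp_codRestrict]

lemma IsHom.isSubcomodule_map {X Y : FDComod k M} {f : X.carrier →ₗ[k] Y.carrier}
    (hf : IsHom f) {W : Submodule k X.carrier} (hW : X.IsSubcomodule W) :
    Y.IsSubcomodule (W.map f) := by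
  have := (hf.comp (X.isHom_subIncl W hW)).isSubcomodule_range
  rwa [LinearMap.range_comp, range_subIncl] at this

lemma IsHom.isSubcomodule_comap {X Y : FDComod k M} {f : X.carrier →ₗ[k] Y.carrier}
    (hf : IsHom f) {W : Submodule k Y.carrier} (hW : Y.IsSubcomodule W) :
    X.IsSubcomodule (W.comap f) := by
  intro v hv
  -- The induced map from `X` modulo the preimage of `W` to `Y` modulo `W` is injective and stays so
  -- after tensoring with `M`, so the vanishing condition pulls back.
  have hinj : Function.Injective ((W.comap f).mapQ W f le_rfl) := by
    rw [← LinearMap.ker_eq_bot, Submodule.ker_mapQ, Submodule.mkQ_map_self]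
  have h := hW _ hv
  rw [range_lTensor_subtype, LinearMap.mem_ker] at h ⊢
  apply lTensor_injective hinj
  rw [map_zero, ← LinearMap.lTensor_comp_apply, Submodule.mapQ_mkQ, LinearMap.lTensor_comp_apply,
    ← hf, h]

lemma isSubcomodule_bot (X : FDComod k M) : X.IsSubcomodule ⊥ := by
  intro w hw
  rw [Submodule.mem_bot] at hw
  simp [hw]

lemma isSubcomodule_top (X : FDComod k M) : X.IsSubcomodule ⊤ := by
  intro w _
  exact LinearMap.lTensor_surjective M (fun v => ⟨⟨v, trivial⟩, rfl⟩) _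

/-- If `Y` embeds into a quotient of `Z`, then `Y` is a subquotient of `Z`. -/
lemma isSubquotient_of_injective_of_surjective {X Y Z : FDComod k M}
    {i : Y.carrier →ₗ[k] X.carrier} (hi : IsHom i) (hinj : Function.Injective i)
    {p : Z.carrier →ₗ[k] X.carrier} (hp : IsHom p) (hsurj : Function.Surjective p) :
    IsSubquotient Y Z := by
  -- The intermediate subobject is the preimage in `Z` of the image of `Y`; it maps onto `Y` by `p`
  -- followed by the inverse of `i` on its range.
  have hW := hp.isSubcomodule_comap hi.isSubcomodule_range
  set W := (LinearMap.range i).comap p with hWdef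
  let j := Z.subIncl W hW
  have hj : ∀ w, p (j w) ∈ LinearMap.range i := fun w => by
    have := LinearMap.mem_range_self j w
    rwa [range_subIncl Z W hW] at this
  let e := LinearEquiv.ofInjective i hinj
  let q : (Z.subObj W hW).carrier →ₗ[k] Y.carrier := e.symm.toLinearMap ∘ₗ
    (p ∘ₗ j).codRestrict (LinearMap.range i) hj
  have hq : i ∘ₗ q = p ∘ₗ j := LinearMap.ext fun w =>
    congrArg Subtype.val (e.apply_symm_apply ((p ∘ₗ j).codRestrict (LinearMap.range i) hj w))
  refine ⟨Z.subObj W hW, j, q, Z.isHom_subIncl W hW, subIncl_injective .., fun w => ?_,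
    fun y => ?_⟩
  · apply lTensor_injective hinj
    rw [← hi, ← LinearMap.lTensor_comp_apply, hq, ← LinearMap.comp_apply i q, hq]
    exact hp.comp (Z.isHom_subIncl W hW) w
  · obtain ⟨z, hz⟩ := hsurj (i y)
    have : z ∈ LinearMap.range j := (range_subIncl Z W hW).symm ▸ ⟨y, hz.symm⟩
    obtain ⟨w, rfl⟩ := this
    refine ⟨w, hinj ?_⟩
    rw [← LinearMap.comp_apply, hq, LinearMap.comp_apply, hz]

/-! ### Cofree comodules -/

/-- The cofree comodule `M ⊗ V`. -/
noncomputable abbrev cofree [Module.Finite k M] (V : Type u) [AddCommGroup V] [Module k V]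
    [Module.Finite k V] : FDComod k M where
  carrier := M ⊗[k] V
  coact := (TensorProduct.assoc k M M V).toLinearMap ∘ₗ (comul (R := k)).rTensor V
  coassoc z := by
    induction z using TensorProduct.induction_on with
    | zero => simp
    | add x y hx hy => simp only [map_add, hx, hy]
    | tmul a v =>
      have h := congrArg (fun t => (TensorProduct.assoc k M M V).toLinearMap.lTensor M
        (TensorProduct.assoc k M (M ⊗[k] M) V (t ⊗ₜ[k] v))) (coassoc_apply (R := k) a)
      simp only [LinearMap.comp_apply, LinearMap.rTensor_tmul, LinearEquiv.coe_coe] at h ⊢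
      generalize comul (R := k) a = z at h ⊢
      refine Eq.trans ?_ (h.trans ?_)
      · clear h
        induction z using TensorProduct.induction_on with
        | zero => simp
        | add x y hx hy => simp only [TensorProduct.add_tmul, map_add, hx, hy]
        | tmul b c =>
          simp only [TensorProduct.assoc_tmul, LinearMap.rTensor_tmul]
          generalize comul (R := k) b = z
          induction z using TensorProduct.induction_on with
          | zero => simp
          | add x y hx hy => simp only [TensorProduct.add_tmul, map_add, hx, hy]
          | tmul d e => simp
      · clear h
        induction z using TensorProduct.induction_on with
        | zero => simp
        | add x y hx hy => simp only [TensorProduct.add_tmul, map_add, hx, hy]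
        | tmul b c => simp
  counit_coact z := by
    induction z using TensorProduct.induction_on with
    | zero => simp
    | add x y hx hy => simp only [map_add, TensorProduct.tmul_add, hx, hy]
    | tmul a v =>
      have h := congrArg (fun t => TensorProduct.assoc k k M V (t ⊗ₜ[k] v))
        (rTensor_counit_comul (R := k) a)
      simp only [LinearMap.comp_apply, LinearMap.rTensor_tmul, LinearEquiv.coe_coe,
        TensorProduct.assoc_tmul] at h ⊢
      rw [← h]
      generalize comul (R := k) a = z
      induction z using TensorProduct.induction_on with
      | zero => simp
      | add x y hx hy => simp only [TensorProduct.add_tmul, map_add, hx, hy]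
      | tmul b c => simp

lemma cofree_coact_tmul [Module.Finite k M] {V : Type u} [AddCommGroup V] [Module k V]
    [Module.Finite k V] (a : M) (v : V) :
    (cofree (k := k) (M := M) V).coact (a ⊗ₜ[k] v) =
      TensorProduct.assoc k M M V (comul (R := k) a ⊗ₜ[k] v) := rfl

/-- This is the coassociativity axiom itself. With `coact_injective`, it embeds every comodule into
a cofree one. -/
lemma isHom_coact [Module.Finite k M] (Y : FDComod k M) :
    IsHom (X := Y) (Y := cofree Y.carrier) Y.coact := fun v => Y.coassoc v

lemma coact_injective (Y : FDComod k M) : Function.Injective Y.coact := by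
  intro v w h
  have := congrArg (fun t => TensorProduct.lid k _ ((counit (R := k)).rTensor Y.carrier t)) h
  simpa [Y.counit_coact] using this

/-! ### Matrix coefficients -/

/-- The matrix coefficient map `v ↦ v₋₁ f(v₀)`. -/
noncomputable def coeff (X : FDComod k M) (f : X.carrier →ₗ[k] k) : X.carrier →ₗ[k] M :=
  evalRight f ∘ₗ X.coact

/-- In Sweedler notation both sides are `v₋₂ ⊗ v₋₁ f(v₀)`, by coassociativity. Thus `X.coeff f` is a
comodule map to `M` coacting on itself by `Δ`. -/
lemma comul_coeff (X : FDComod k M) (f : X.carrier →ₗ[k] k) (v : X.carrier) :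
    comul (R := k) (X.coeff f v) = (X.coeff f).lTensor M (X.coact v) := by
  have h : ∀ z : M ⊗[k] X.carrier, comul (R := k) (evalRight f z) =
      (evalRight f).lTensor M
        (TensorProduct.assoc k M M _ ((comul (R := k)).rTensor X.carrier z)) := by
    intro z
    induction z using TensorProduct.induction_on with
    | zero => simp
    | add x y hx hy => simp only [map_add, hx, hy]
    | tmul a w =>
      simp only [evalRight_tmul, map_smul, LinearMap.rTensor_tmul]
      generalize comul (R := k) a = z
      induction z using TensorProduct.induction_on with
      | zero => simp
      | add x y hx hy => simp only [TensorProduct.add_tmul, map_add, smul_add, hx, hy]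
      | tmul b c => simp
  rw [coeff, LinearMap.comp_apply, h, X.coassoc, ← LinearMap.lTensor_comp_apply]

/-- The comodule map `v ↦ v₋₁ f(v₀) ⊗ y` into a cofree comodule. -/
lemma isHom_coeff_tmul [Module.Finite k M] (X : FDComod k M) (f : X.carrier →ₗ[k] k) {V : Type u}
    [AddCommGroup V] [Module k V] [Module.Finite k V] (y : V) :
    IsHom (X := X) (Y := cofree V) ((TensorProduct.mk k M V).flip y ∘ₗ X.coeff f) := fun v => by
  refine (cofree_coact_tmul _ _).trans ?_
  have h : ∀ z : M ⊗[k] X.carrier,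
      TensorProduct.assoc k M M V ((X.coeff f).lTensor M z ⊗ₜ[k] y) =
        ((TensorProduct.mk k M V).flip y ∘ₗ X.coeff f).lTensor M z := by
    intro z
    induction z using TensorProduct.induction_on with
    | zero => simp
    | add x y hx hy => simp only [TensorProduct.add_tmul, map_add, hx, hy]
    | tmul a w => simp
  rw [comul_coeff, h]

/-- All matrix coefficients of `X` lie in `N`. -/
def CoeffsIn (X : FDComod k M) (N : Submodule k M) : Prop :=
  ∀ f v, X.coeff f v ∈ N

lemma IsHom.coeff_apply {X Y : FDComod k M} {p : X.carrier →ₗ[k] Y.carrier} (hp : IsHom p)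
    (f : Y.carrier →ₗ[k] k) (v : X.carrier) : Y.coeff f (p v) = X.coeff (f ∘ₗ p) v := by
  rw [coeff, LinearMap.comp_apply, hp, evalRight_lTensor]
  rfl

lemma CoeffsIn.of_surjective {X Y : FDComod k M} {N : Submodule k M} (h : X.CoeffsIn N)
    {p : X.carrier →ₗ[k] Y.carrier} (hp : IsHom p) (hs : Function.Surjective p) :
    Y.CoeffsIn N := fun f v => by
  obtain ⟨w, rfl⟩ := hs v
  exact hp.coeff_apply f w ▸ h _ _

lemma CoeffsIn.of_injective {X Y : FDComod k M} {N : Submodule k M} (h : Y.CoeffsIn N)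
    {i : X.carrier →ₗ[k] Y.carrier} (hi : IsHom i) (hinj : Function.Injective i) :
    X.CoeffsIn N := fun f v => by
  -- A merely linear retraction `g` suffices: it extends the functional `f` to `Y`.
  obtain ⟨g, hg⟩ := i.exists_leftInverse_of_injective (LinearMap.ker_eq_bot.2 hinj)
  have := hi.coeff_apply (f ∘ₗ g) v
  rw [LinearMap.comp_assoc, hg, LinearMap.comp_id] at this
  exact this ▸ h _ _

lemma CoeffsIn.of_isSubquotient {X Y : FDComod k M} {N : Submodule k M} (h : X.CoeffsIn N)
    (hY : IsSubquotient Y X) : Y.CoeffsIn N := by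
  obtain ⟨W, i, p, hi, hinj, hp, hs⟩ := hY
  exact (h.of_injective hi hinj).of_surjective hp hs

/-- The inclusion of a summand into a direct sum. -/
noncomputable def sumIncl {n : ℕ} (X : Fin n → FDComod k M) (i : Fin n) :
    (X i).carrier →ₗ[k] (directSum X).carrier :=
  LinearMap.single k (fun i => (X i).carrier) i

/-- The projection of a direct sum to a summand. -/
noncomputable def sumProj {n : ℕ} (X : Fin n → FDComod k M) (i : Fin n) :
    (directSum X).carrier →ₗ[k] (X i).carrier :=
  LinearMap.proj (φ := fun i => (X i).carrier) i

lemma sumProj_comp_sumIncl_self {n : ℕ} (X : Fin n → FDComod k M) (i : Fin n) :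
    sumProj X i ∘ₗ sumIncl X i = LinearMap.id :=
  LinearMap.proj_comp_single_same k (fun i => (X i).carrier) i

lemma sumProj_comp_sumIncl_of_ne {n : ℕ} (X : Fin n → FDComod k M) {i j : Fin n} (h : i ≠ j) :
    sumProj X i ∘ₗ sumIncl X j = 0 := by
  ext v
  exact Pi.single_eq_of_ne (M := fun i => (X i).carrier) h v

lemma directSum_coact {n : ℕ} (X : Fin n → FDComod k M) (v : (directSum X).carrier) :
    (directSum X).coact v =
      ∑ i, (sumIncl X i).lTensor M ((X i).coact (sumProj X i v)) :=
  LinearMap.sum_apply Finset.univ (fun i => (LinearMap.single k (fun i => (X i).carrier) i).lTensor M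
    ∘ₗ (X i).coact ∘ₗ LinearMap.proj (φ := fun i => (X i).carrier) i) v

lemma CoeffsIn.directSum {n : ℕ} {X : Fin n → FDComod k M} {N : Submodule k M}
    (h : ∀ i, (X i).CoeffsIn N) : (directSum X).CoeffsIn N := fun f v => by
  rw [coeff, LinearMap.comp_apply, directSum_coact, map_sum]
  refine Submodule.sum_mem _ fun i _ => ?_
  rw [evalRight_lTensor]
  exact h i _ _

lemma sum_comp_sumProj_comp_sumIncl {n : ℕ} {X : Fin n → FDComod k M} {V : Type*} [AddCommGroup V]
    [Module k V] (p : ∀ i, (X i).carrier →ₗ[k] V) (i : Fin n) :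
    (∑ j, p j ∘ₗ sumProj X j) ∘ₗ sumIncl X i = p i := by
  ext w
  rw [LinearMap.comp_apply, LinearMap.sum_apply, Finset.sum_eq_single i, LinearMap.comp_apply,
    ← LinearMap.comp_apply (sumProj X i), sumProj_comp_sumIncl_self, LinearMap.id_apply]
  · intro j _ hj
    rw [LinearMap.comp_apply, ← LinearMap.comp_apply (sumProj X j),
      sumProj_comp_sumIncl_of_ne X hj, LinearMap.zero_apply, map_zero]
  · simp

/-- The sum of comodule maps out of the summands of a direct sum. -/
lemma isHom_sum_comp_sumProj {n : ℕ} {X : Fin n → FDComod k M} {Y : FDComod k M}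
    {p : ∀ i, (X i).carrier →ₗ[k] Y.carrier} (hp : ∀ i, IsHom (p i)) :
    IsHom (∑ i, p i ∘ₗ sumProj X i) := fun v => by
  rw [directSum_coact, map_sum, LinearMap.sum_apply, map_sum]
  refine Finset.sum_congr rfl fun i _ => ?_
  rw [← LinearMap.lTensor_comp_apply, LinearMap.comp_apply, hp i, sum_comp_sumProj_comp_sumIncl]

/-- Every element of `M` is a matrix coefficient of the regular comodule. -/
lemma eq_top_of_coeffsIn_cofree [Module.Finite k M] {N : Submodule k M}
    (h : (cofree (k := k) (M := M) k).CoeffsIn N) : N = ⊤ := by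
  refine eq_top_iff.2 fun a _ => ?_
  -- The coefficient of `a ⊗ 1` at the functional `ε ⊗ id` is `a₁ ε(a₂) = a`.
  have ha := h ((TensorProduct.lid k k).toLinearMap ∘ₗ (counit (R := k)).rTensor k)
    (a ⊗ₜ[k] (1 : k))
  have hc := congrArg (TensorProduct.rid k M) (lTensor_counit_comul (R := k) a)
  rw [coeff, LinearMap.comp_apply, cofree_coact_tmul] at ha
  convert ha
  rw [TensorProduct.rid_tmul, one_smul] at hc
  refine hc.symm.trans ?_
  generalize comul (R := k) a = z
  induction z using TensorProduct.induction_on with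
  | zero => simp
  | add x y hx hy => simp only [TensorProduct.add_tmul, map_add, hx, hy]
  | tmul b c => simp

end Coalgebra

end FDComod

namespace FDComod

/-! ### Objects of length two and skew-primitive elements -/

section Length

variable {k M : Type u} [Field k] [AddCommGroup M] [Module k M] [Coalgebra k M]

lemma tmul_left_injective {A : Type u} {V : Type*} [AddCommGroup A] [Module k A] [AddCommGroup V] [Module k V]
    {e : V} (he : e ≠ 0) {a b : A} (h : a ⊗ₜ[k] e = b ⊗ₜ[k] e) : a = b := by
  obtain ⟨f, hf⟩ : ∃ f : V →ₗ[k] k, f e ≠ 0 := by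
    by_contra! hf
    exact he ((Module.forall_dual_apply_eq_zero_iff k e).1 hf)
  have := congrArg (evalRight f) h
  rw [evalRight_tmul, evalRight_tmul] at this
  exact smul_right_injective _ hf this

lemma exists_eq_tmul {A V : Type*} [AddCommGroup A] [Module k A] [AddCommGroup V] [Module k V]
    {e : V} (he : ∀ v : V, ∃ c : k, c • e = v) (z : A ⊗[k] V) : ∃ a : A, z = a ⊗ₜ[k] e := by
  induction z using TensorProduct.induction_on with
  | zero => exact ⟨0, by simp⟩
  | add x y hx hy =>
    obtain ⟨a, rfl⟩ := hx
    obtain ⟨b, rfl⟩ := hy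
    exact ⟨a + b, (TensorProduct.add_tmul _ _ _).symm⟩
  | tmul a v =>
    obtain ⟨c, rfl⟩ := he v
    exact ⟨c • a, (TensorProduct.smul_tmul _ _ _).symm⟩

/-- A one-dimensional comodule is given by a grouplike element. -/
lemma exists_isGroupLikeElem_of_finrank_eq_one (X : FDComod k M)
    (h : Module.finrank k X.carrier = 1) :
    ∃ (e : X.carrier) (g : M), e ≠ 0 ∧ (∀ v, ∃ c : k, c • e = v) ∧ IsGroupLikeElem k g ∧
      X.coact e = g ⊗ₜ[k] e := by
  obtain ⟨e, he, hspan⟩ := finrank_eq_one_iff'.1 h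
  obtain ⟨g, hg⟩ := exists_eq_tmul hspan (X.coact e)
  refine ⟨e, g, he, hspan, ⟨?_, ?_⟩, hg⟩
  · have := X.counit_coact e
    rw [hg, LinearMap.rTensor_tmul] at this
    exact tmul_left_injective he this
  · have := X.coassoc e
    rw [hg, LinearMap.rTensor_tmul, LinearMap.lTensor_tmul, hg,
      ← TensorProduct.assoc_tmul] at this
    exact tmul_left_injective he ((TensorProduct.assoc k M M X.carrier).injective this)

/-- A comodule of length `2` is an extension of two simple comodules. -/
lemma exists_isSimple_of_length_eq_two {X : FDComod k M} (h : X.length = 2) :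
    ∃ (W : Submodule k X.carrier) (hW : X.IsSubcomodule W),
      (X.subObj W hW).IsSimple ∧ (X.quotObj W hW).IsSimple := by
  obtain ⟨l, hl⟩ := Order.le_krullDim_iff.1 (show ((2 : ℕ) : WithBot ℕ∞) ≤ X.length from h.ge)
  -- No strict chain has four terms, so the middle term `W` of a three-term chain lies strictly
  -- between `⊥` and `⊤` and admits no refinement on either side.
  have h3 : ∀ A B C D : X.Subcomodule, A < B → B < C → C < D → False := by
    intro A B C D hAB hBC hCD
    have : ((3 : ℕ) : WithBot ℕ∞) ≤ X.length :=
      Order.le_krullDim_iff.2 ⟨⟨3, ![A, B, C, D], fun i => by fin_cases i <;> assumption⟩, rfl⟩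
    rw [h] at this
    exact absurd this (by decide)
  let B : X.Subcomodule := ⟨⊥, X.isSubcomodule_bot⟩
  let T : X.Subcomodule := ⟨⊤, X.isSubcomodule_top⟩
  have h01 : l ⟨0, by omega⟩ < l ⟨1, by omega⟩ := l.strictMono (by simp [Fin.lt_def])
  have h12 : l ⟨1, by omega⟩ < l ⟨2, by omega⟩ := l.strictMono (by simp [Fin.lt_def])
  set W := l ⟨1, by omega⟩
  have hB : B < W := lt_of_le_of_lt (b := l ⟨0, by omega⟩) (Subtype.mk_le_mk.2 bot_le) h01
  have hT : W < T := lt_of_lt_of_le (b := l ⟨2, by omega⟩) h12 (Subtype.mk_le_mk.2 le_top)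
  have hB' : (⊥ : Submodule k X.carrier) < W.1 := hB
  have hT' : W.1 < (⊤ : Submodule k X.carrier) := hT
  refine ⟨W.1, W.2, ⟨?_, fun U hU => ?_⟩, ?_, fun U hU => ?_⟩
  · exact Submodule.nontrivial_iff_ne_bot.2 hB'.ne'
  · have hUW : U.map (X.subIncl W.1 W.2) ≤ W.1 :=
      LinearMap.map_le_range.trans_eq (range_subIncl ..)
    let V : X.Subcomodule := ⟨_, (X.isHom_subIncl W.1 W.2).isSubcomodule_map hU⟩
    rcases hUW.eq_or_lt with heq | hlt
    · right
      apply Submodule.map_injective_of_injective (X.subIncl_injective W.1 W.2)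
      rw [heq, Submodule.map_top, range_subIncl]
    · left
      by_contra hne
      have : (⊥ : Submodule k X.carrier) < U.map (X.subIncl W.1 W.2) := by
        rw [bot_lt_iff_ne_bot]
        intro h0
        apply hne
        apply Submodule.map_injective_of_injective (X.subIncl_injective W.1 W.2)
        rw [h0, Submodule.map_bot]
      exact h3 B V W T this hlt hT
  · exact Submodule.Quotient.nontrivial_iff.2 hT'.ne
  -- A proper nonzero subobject of the quotient would have its preimage strictly between `W` and
  -- `⊤`.
  · have hUW : W.1 ≤ U.comap (X.quotProj W.1 W.2) :=
      (ker_quotProj ..).symm.trans_le (LinearMap.ker_le_comap _)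
    let V : X.Subcomodule := ⟨_, (X.isHom_quotProj W.1 W.2).isSubcomodule_comap hU⟩
    rcases hUW.eq_or_lt with heq | hlt
    · left
      apply Submodule.comap_injective_of_surjective (X.quotProj_surjective W.1 W.2)
      rw [← heq, ← LinearMap.ker, ker_quotProj]
    · right
      by_contra hne
      have : U.comap (X.quotProj W.1 W.2) < ⊤ := by
        rw [lt_top_iff_ne_top]
        intro h0
        apply hne
        apply Submodule.comap_injective_of_surjective (X.quotProj_surjective W.1 W.2)
        rw [h0, Submodule.comap_top]
      exact h3 B W V T hB hlt this

/-- A coefficient space containing grouplike and skew-primitive elements contains the coefficients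
of the objects of length `2`, if `M` is pointed. -/
lemma coeffsIn_of_length_eq_two (hM : IsPointedCoalgebra k M) {N : Submodule k M}
    (hg : ∀ g : M, IsGroupLikeElem k g → g ∈ N) (hx : ∀ x : M, IsSkewPrimitive k x → x ∈ N)
    {X : FDComod k M} (h : X.length = 2) : X.CoeffsIn N := by
  obtain ⟨W, hW, hs, hq⟩ := exists_isSimple_of_length_eq_two h
  obtain ⟨e, a, he, hespan, ha, hea⟩ := exists_isGroupLikeElem_of_finrank_eq_one _ (hM _ hs)
  obtain ⟨e', b, he', hespan', hb, heb⟩ := exists_isGroupLikeElem_of_finrank_eq_one _ (hM _ hq)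
  obtain ⟨y, rfl⟩ := X.quotProj_surjective W hW e'
  set i := X.subIncl W hW with hi
  set p := X.quotProj W hW with hp
  have hiinj : Function.Injective i := X.subIncl_injective W hW
  have hie : i e ≠ 0 := fun h0 => he (hiinj (h0.trans (map_zero i).symm))
  have hexact : Function.Exact i p := by
    rw [LinearMap.exact_iff, ker_quotProj, range_subIncl]
  have hcoe : X.coact (i e) = a ⊗ₜ[k] i e := by
    rw [X.isHom_subIncl W hW e, hea, LinearMap.lTensor_tmul]
  -- The lift `y` of the generator of the quotient coacts by `b ⊗ y` up to an element of `M ⊗ W`,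
  -- and `W` is the line through `i e`.
  obtain ⟨x, hy⟩ : ∃ x : M, X.coact y = b ⊗ₜ[k] y + x ⊗ₜ[k] i e := by
    have h0 : p.lTensor M (X.coact y - b ⊗ₜ[k] y) = 0 := by
      rw [map_sub, LinearMap.lTensor_tmul, ← heb, X.isHom_quotProj W hW y, sub_self]
    obtain ⟨t, ht⟩ := (lTensor_exact M hexact (X.quotProj_surjective W hW) _).1 h0
    obtain ⟨x, rfl⟩ := exists_eq_tmul hespan t
    refine ⟨x, ?_⟩
    rw [← LinearMap.lTensor_tmul, ht, add_sub_cancel]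
  have hxN : x ∈ N := by
    refine hx x ⟨b, a, hb, ha, tmul_left_injective hie
      ((TensorProduct.assoc k M M X.carrier).injective ?_)⟩
    -- Cancelling `b ⊗ b ⊗ y` from coassociativity at `y` and comparing the factors of `i e` gives
    -- `Δ(x) = b ⊗ x + x ⊗ a`.
    have := X.coassoc y
    simp only [hy, map_add, LinearMap.rTensor_tmul, LinearMap.lTensor_tmul, hcoe,
      hb.comul_eq_tmul_self, TensorProduct.assoc_tmul, TensorProduct.tmul_add] at this
    rw [add_assoc] at this
    rw [add_left_cancel this]
    simp [TensorProduct.add_tmul]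
  intro f v
  obtain ⟨c, hc⟩ := hespan' (p v)
  obtain ⟨w, hw⟩ := (hexact (v - c • y)).1 (by rw [map_sub, map_smul, hc, sub_self])
  obtain ⟨d, rfl⟩ := hespan w
  have hv : v = c • y + d • i e := by rw [← map_smul, hw, add_sub_cancel]
  rw [hv, map_add, map_smul, map_smul]
  refine N.add_mem (N.smul_mem _ ?_) (N.smul_mem _ ?_)
  · rw [coeff, LinearMap.comp_apply, hy, map_add, evalRight_tmul, evalRight_tmul]
    exact N.add_mem (N.smul_mem _ (hg b hb)) (N.smul_mem _ hxN)
  · rw [coeff, LinearMap.comp_apply, hcoe, evalRight_tmul]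
    exact N.smul_mem _ (hg a ha)

/-- Applying `ε` to the first leg gives `x = x + ε(x) h`, and a grouplike `h` is nonzero. -/
lemma counit_eq_zero_of_comul {g h x : M} (hg : IsGroupLikeElem k g) (hh : IsGroupLikeElem k h)
    (hx : comul (R := k) x = g ⊗ₜ[k] x + x ⊗ₜ[k] h) : counit (R := k) x = 0 := by
  have := rTensor_counit_comul (R := k) x
  rw [hx, map_add, LinearMap.rTensor_tmul, LinearMap.rTensor_tmul, hg.counit_eq_one,
    add_eq_left] at this
  refine tmul_left_injective hh.ne_zero (this.trans (TensorProduct.zero_tmul _ _).symm)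

/-- The two-dimensional comodule with matrix coefficients `g`, `x`, `h`. -/
noncomputable abbrev skewPrimitiveObj {g h x : M} (hg : IsGroupLikeElem k g)
    (hh : IsGroupLikeElem k h) (hx : comul (R := k) x = g ⊗ₜ[k] x + x ⊗ₜ[k] h) : FDComod k M where
  carrier := k × k
  coact := LinearMap.coprod (LinearMap.toSpanSingleton k _ (h ⊗ₜ[k] ((1, 0) : k × k)))
    (LinearMap.toSpanSingleton k _ (g ⊗ₜ[k] ((0, 1) : k × k) + x ⊗ₜ[k] ((1, 0) : k × k)))
  coassoc v := by
    simp [hg.comul_eq_tmul_self, hh.comul_eq_tmul_self, hx, TensorProduct.add_tmul,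
      TensorProduct.tmul_add, add_assoc]
  counit_coact v := by
    rcases v with ⟨a, b⟩
    simp [hg.counit_eq_one, hh.counit_eq_one, counit_eq_zero_of_comul hg hh hx,
      ← TensorProduct.tmul_smul, ← TensorProduct.tmul_add]

/-- The dimension bounds the length above, and the invariant line through `(1, 0)` bounds it below.
The case `x = 0` is included and gives a direct sum. -/
lemma length_skewPrimitiveObj {g h x : M} (hg : IsGroupLikeElem k g)
    (hh : IsGroupLikeElem k h) (hx : comul (R := k) x = g ⊗ₜ[k] x + x ⊗ₜ[k] h) :
    (skewPrimitiveObj hg hh hx).length = 2 := by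
  set X := skewPrimitiveObj hg hh hx with hX
  apply le_antisymm
  · have h2 : Module.length k (k × k) = 2 := by
      rw [Module.length_eq_finrank]; simp
    have := Order.krullDim_le_of_strictMono (fun W : X.Subcomodule => W.1)
      (fun _ _ hlt => hlt)
    refine this.trans ?_
    have h3 := Module.coe_length k (k × k)
    rw [h2] at h3
    exact h3.ge
  · let W : Submodule k (k × k) := Submodule.span k {(1, 0)}
    have hW : X.IsSubcomodule W := by
      intro w hw
      obtain ⟨c, rfl⟩ := Submodule.mem_span_singleton.1 hw
      refine ⟨(c • h) ⊗ₜ[k] ⟨(1, 0), Submodule.mem_span_singleton_self _⟩, ?_⟩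
      rw [LinearMap.lTensor_tmul, map_smul, ← TensorProduct.smul_tmul']
      have h10 : X.coact ((1, 0) : k × k) = h ⊗ₜ[k] ((1, 0) : k × k) := by
        refine (LinearMap.coprod_apply _ _ _).trans ?_
        simp
      rw [h10, Submodule.subtype_apply]
    have hbot : (⊥ : Submodule k (k × k)) < W := by
      rw [bot_lt_iff_ne_bot, ne_eq, Submodule.span_singleton_eq_bot]
      simp
    have htop : W < ⊤ := by
      rw [lt_top_iff_ne_top]
      intro h0
      have : ((0, 1) : k × k) ∈ W := h0 ▸ trivial
      obtain ⟨c, hc⟩ := Submodule.mem_span_singleton.1 this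
      simpa using congrArg Prod.snd hc
    let B : X.Subcomodule := ⟨⊥, X.isSubcomodule_bot⟩
    let T : X.Subcomodule := ⟨⊤, X.isSubcomodule_top⟩
    have h1 : B < ⟨W, hW⟩ := hbot
    have h2 : ⟨W, hW⟩ < T := htop
    exact Order.le_krullDim_iff (n := 2).2
      ⟨⟨2, ![B, ⟨W, hW⟩, T], fun i => by fin_cases i <;> assumption⟩, rfl⟩

end Length

/-! ### Coefficients of tensor products and tensor generation -/

section Tensor

variable {k M : Type u} [Field k] [AddCommGroup M] [Module k M] [Coalgebra k M]
  [CoquasiHopfAlgebra k M]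

lemma evalRight_tensor {V W : Type u} [AddCommGroup V] [Module k V] [AddCommGroup W] [Module k W]
    (f : V →ₗ[k] k) (g : W →ₗ[k] k) (x : M ⊗[k] V) (y : M ⊗[k] W) :
    evalRight ((TensorProduct.lid k k).toLinearMap ∘ₗ TensorProduct.map f g)
      ((CoquasiHopfAlgebra.mul (k := k) (M := M)).toLinearMap.rTensor (V ⊗[k] W)
        (TensorProduct.tensorTensorTensorComm k M V M W (x ⊗ₜ[k] y))) =
      CoquasiHopfAlgebra.mul (k := k) (evalRight f x ⊗ₜ[k] evalRight g y) := by
  induction x using TensorProduct.induction_on with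
  | zero => simp
  | add x x' hx hx' => simp only [TensorProduct.add_tmul, map_add, hx, hx']
  | tmul a v =>
    induction y using TensorProduct.induction_on with
    | zero => simp
    | add y y' hy hy' => simp only [TensorProduct.tmul_add, map_add, hy, hy']
    | tmul b w =>
      simp [← TensorProduct.smul_tmul', TensorProduct.tmul_smul, mul_smul, smul_comm (f v)]

lemma coeff_tensorObj (X Y : FDComod k M) (f : X.carrier →ₗ[k] k) (g : Y.carrier →ₗ[k] k)
    (v : X.carrier) (w : Y.carrier) :
    (tensorObj X Y).coeff ((TensorProduct.lid k k).toLinearMap ∘ₗ TensorProduct.map f g)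
      (v ⊗ₜ[k] w) = CoquasiHopfAlgebra.mul (k := k) (X.coeff f v ⊗ₜ[k] Y.coeff g w) :=
  evalRight_tensor f g (X.coact v) (Y.coact w)

/-- A functional on `X ⊗ Y` need not be a pure tensor, so both coactions are expanded in bases; each
resulting term is a multiple of a product of coefficients. -/
lemma CoeffsIn.tensorObj {X Y : FDComod k M} {N : Submodule k M}
    (hN : ∀ a ∈ N, ∀ b ∈ N, CoquasiHopfAlgebra.mul (k := k) (a ⊗ₜ[k] b) ∈ N)
    (hX : X.CoeffsIn N) (hY : Y.CoeffsIn N) : (tensorObj X Y).CoeffsIn N := by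
  let b := Module.finBasis k X.carrier
  let c := Module.finBasis k Y.carrier
  have key : ∀ (F : X.carrier ⊗[k] Y.carrier →ₗ[k] k) (z : X.carrier ⊗[k] Y.carrier),
      evalRight F (tensorCoact X Y z) ∈ N := by
    intro F z
    induction z using TensorProduct.induction_on with
    | zero => simp
    | add x y hx hy => rw [map_add, map_add]; exact N.add_mem hx hy
    | tmul v w =>
      have h : tensorCoact X Y (v ⊗ₜ[k] w) =
          (CoquasiHopfAlgebra.mul (k := k) (M := M)).toLinearMap.rTensor _
            (TensorProduct.tensorTensorTensorComm k M X.carrier M Y.carrier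
              (X.coact v ⊗ₜ[k] Y.coact w)) := rfl
      rw [h, ← sum_evalRight_coord b (X.coact v), ← sum_evalRight_coord c (Y.coact w)]
      simp only [TensorProduct.sum_tmul, TensorProduct.tmul_sum, map_sum,
        TensorProduct.tensorTensorTensorComm_tmul, LinearMap.rTensor_tmul, evalRight_tmul]
      exact N.sum_mem fun i _ => N.sum_mem fun j _ => N.smul_mem _
        (hN _ (hX (b.coord j) v) _ (hY (c.coord i) w))
  exact key

lemma isGroupLikeElem_one :
    IsGroupLikeElem k (CoquasiHopfAlgebra.unit (1 : k) : M) :=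
  IsGroupLikeElem.map CoquasiHopfAlgebra.unit (isGroupLikeElem_self.2 rfl)

/-- The empty word is where grouplikes enter: the coefficients of the unit object are the multiples
of `1`. -/
lemma IsTensorWord.coeffsIn {P : FDComod k M → Prop} {N : Submodule k M}
    (hg : ∀ g : M, IsGroupLikeElem k g → g ∈ N)
    (hN : ∀ a ∈ N, ∀ b ∈ N, CoquasiHopfAlgebra.mul (k := k) (a ⊗ₜ[k] b) ∈ N)
    (hP : ∀ X, P X → X.CoeffsIn N) {X : FDComod k M} (hX : IsTensorWord P X) : X.CoeffsIn N := by
  induction hX with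
  | unit =>
    intro f v
    have h : (unitObj k M).coeff f v = f v • CoquasiHopfAlgebra.unit (1 : k) :=
      evalRight_tmul f (CoquasiHopfAlgebra.unit (1 : k) : M) v
    exact h ▸ N.smul_mem _ (hg _ isGroupLikeElem_one)
  | of X hX => exact hP X hX
  | tensor X Y _ _ hX hY => exact CoeffsIn.tensorObj hN hX hY

variable (k M) in
/-- The coefficients of tensor words in objects of length `2` span `M`, if `M` is generated by
grouplike and skew-primitive elements. -/
lemma span_coeff_tensorWord_eq_top (h : GeneratedByGroupLikeAndSkewPrimitive k M) :
    Submodule.span k {a : M | ∃ X : FDComod k M,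
      IsTensorWord (fun X : FDComod k M => X.length = 2) X ∧ ∃ f v, X.coeff f v = a} = ⊤ := by
  apply h
  · intro g hg
    -- The one-dimensional comodule of `g` has length `1`, so `g` is realised in the length `2`
    -- object attached to `0` viewed as a skew-primitive element.
    have h0 : comul (R := k) (0 : M) = g ⊗ₜ[k] 0 + 0 ⊗ₜ[k] g := by simp
    refine Submodule.subset_span ⟨skewPrimitiveObj hg hg h0,
      .of _ (length_skewPrimitiveObj hg hg h0), LinearMap.fst k k k, (1, 0), ?_⟩
    simp [coeff]
  · rintro x ⟨g, h, hg, hh, hx⟩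
    refine Submodule.subset_span ⟨skewPrimitiveObj hg hh hx,
      .of _ (length_skewPrimitiveObj hg hh hx), LinearMap.fst k k k, (0, 1), ?_⟩
    simp [coeff]
  · intro a ha b hb
    induction ha using Submodule.span_induction with
    | zero => simp
    | add x y _ _ hx hy =>
      rw [TensorProduct.add_tmul, map_add]
      exact Submodule.add_mem _ hx hy
    | smul c x _ hx =>
      rw [← TensorProduct.smul_tmul', map_smul]
      exact Submodule.smul_mem _ _ hx
    | mem a ha =>
      induction hb using Submodule.span_induction with
      | zero => simp
      | add x y _ _ hx hy =>
        rw [TensorProduct.tmul_add, map_add]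
        exact Submodule.add_mem _ hx hy
      | smul c x _ hx =>
        rw [TensorProduct.tmul_smul, map_smul]
        exact Submodule.smul_mem _ _ hx
      | mem b hb =>
        obtain ⟨X, hX, f, v, rfl⟩ := ha
        obtain ⟨Y, hY, g, w, rfl⟩ := hb
        exact Submodule.subset_span ⟨tensorObj X Y, .tensor X Y hX hY, _, _,
          coeff_tensorObj X Y f g v w⟩

/-- If the coefficients of tensor words in `P` span `M`, then `P` tensor generates. -/
lemma tensorGeneratedBy_of_span_coeff_eq_top [Module.Finite k M] {P : FDComod k M → Prop}
    (h : Submodule.span k {a : M | ∃ X : FDComod k M,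
      IsTensorWord P X ∧ ∃ f v, X.coeff f v = a} = ⊤) : TensorGeneratedBy P := by
  intro Y
  let Z : FDComod k M := cofree Y.carrier
  let s : Set Z.carrier := {z | ∃ X : FDComod k M, IsTensorWord P X ∧
    ∃ p : X.carrier →ₗ[k] Z.carrier, IsHom p ∧ z ∈ LinearMap.range p}
  have hs : Submodule.span k s = ⊤ := by
    refine Submodule.eq_top_iff'.2 fun z => ?_
    induction z using TensorProduct.induction_on with
    | zero => exact Submodule.zero_mem _
    | add x y hx hy => exact Submodule.add_mem _ hx hy
    | tmul a y =>
      have ha : a ∈ (⊤ : Submodule k M) := trivial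
      rw [← h] at ha
      induction ha using Submodule.span_induction with
      | zero => rw [TensorProduct.zero_tmul]; exact Submodule.zero_mem _
      | add x x' _ _ hx hx' => rw [TensorProduct.add_tmul]; exact Submodule.add_mem _ hx hx'
      | smul c x _ hx => rw [← TensorProduct.smul_tmul']; exact Submodule.smul_mem _ _ hx
      | mem a ha =>
        obtain ⟨X, hX, f, v, rfl⟩ := ha
        exact Submodule.subset_span ⟨X, hX, _, isHom_coeff_tmul X f y, v, rfl⟩
  -- Since `Z` is finite-dimensional, finitely many elements of `s` span it; each contributes one
  -- tensor word to the direct sum.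
  obtain ⟨z, hz, hspan, -⟩ := Submodule.exists_fun_fin_finrank_span_eq k s
  choose X hX p hp hzp using hz
  refine ⟨_, X, hX, isSubquotient_of_injective_of_surjective (isHom_coact Y) Y.coact_injective
    (isHom_sum_comp_sumProj hp) ?_⟩
  refine LinearMap.range_eq_top.1 (top_unique ((hspan.trans hs).symm.trans_le ?_))
  rw [Submodule.span_le]
  rintro _ ⟨i, rfl⟩
  obtain ⟨v, hv⟩ := hzp i
  refine ⟨sumIncl X i v, ?_⟩
  rw [← LinearMap.comp_apply, sum_comp_sumProj_comp_sumIncl, hv]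

end Tensor

end FDComod

/-- A finite-dimensional pointed coquasi-Hopf algebra is generated by grouplike and skew-primitive
elements if and only if its category of finite-dimensional comodules is tensor generated by
objects of length `2`. -/
theorem propositionp5p8 (k M : Type u) [Field k] [IsAlgClosed k] [CharZero k]
    [AddCommGroup M] [Module k M] [Module.Finite k M] [Coalgebra k M] [CoquasiHopfAlgebra k M]
    (hM : IsPointedCoalgebra k M) :
    GeneratedByGroupLikeAndSkewPrimitive k M ↔
      FDComod.TensorGeneratedBy (fun X : FDComod k M => X.length = 2) := by
  refine ⟨fun h => FDComod.tensorGeneratedBy_of_span_coeff_eq_top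
    (FDComod.span_coeff_tensorWord_eq_top k M h), fun h N hg hx hN => ?_⟩
  -- Tensor generation is needed only for the regular comodule, realised as `M ⊗ k`.
  obtain ⟨n, X, hX, hsub⟩ := h (FDComod.cofree (M := M) k)
  refine FDComod.eq_top_of_coeffsIn_cofree (k := k) (FDComod.CoeffsIn.of_isSubquotient
    (FDComod.CoeffsIn.directSum fun i => ?_) hsub)
  exact (hX i).coeffsIn hg hN fun Y hY => FDComod.coeffsIn_of_length_eq_two hM hg hx hY
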